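/- **Theorem 3.1 (Generalized Tchakaloff Theorem, complex case).** For integers $m,d\ge 0$ let $\mathbb{C}_{m,d}[z,\bar z]$ denote the space of complex polynomials $p(z,\bar z)$ in $z=(z_1,\dots,z_d)$ and $\bar z=(\bar z_1,\dots,\bar z_d)$ of total degree at most $m$. Let $n\ge 1$ and let $\mu$ be a positive Borel measure on $\mathbb{C}^d$ having convergent moments up to at least degree $n$, i.e. every $p\in\mathbb{C}_{n,d}[z,\bar z]$ is absolutely integrable with respect to $\mu$. Let $K:=\operatorname{supp}\mu$ be the closed support of $\mu$, and let $N_{n-1,d;\mu}:=\dim\bigl(\mathbb{C}_{n-1,d}[z,\bar z]|_{K}\bigr)$ be the dimension of the space of restrictions to $K$ of the polynomials in $\mathbb{C}_{n-1,d}[z,\bar z]$. Then, for some integer $N$ with $0\le N\le 1+N_{n-1,d;\mu}$, there exist nodes $z_1,\dots,z_N\in K$ and positive weights $\rho_1,\dots,\rho_N$ such that $$\int_K p(z,\bar z)\,d\mu(z)=\sum_{k=1}^N\rho_k\,p(z_k,\bar z_k)\qquad\text{for every } p\in\mathbb{C}_{n-1,d}[z,\bar z].$$ (Necessarily $N=0$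 when $\mu=0$, and $N\ge 1$ otherwise.) -/

import Mathlib

open MeasureTheory

/-- Complex polynomials `p(z, z̄)` in `d` complex variables and their conjugates, as formal
polynomials: `X (Sum.inl k)` stands for `z_k` and `X (Sum.inr k)` for the conjugate of `z_k`. -/
abbrev ConjPoly (d : ℕ) : Type := MvPolynomial (Fin d ⊕ Fin d) ℂ

/-- The value `p(z, z̄)` at `z ∈ ℂ^d`, as a linear map from polynomials to functions on `ℂ^d`. -/
noncomputable def ConjPoly.toFun (d : ℕ) : ConjPoly d →ₗ[ℂ] ((Fin d → ℂ) → ℂ) where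
  toFun p z := MvPolynomial.eval (Sum.elim z (fun k => starRingEnd ℂ (z k))) p
  map_add' p q := by funext z; simp
  map_smul' c p := by funext z; simp

/-- The space `ℂ_{m,d}[z, z̄]` of polynomials in `z, z̄` of total degree at most `m`. -/
noncomputable def conjPolyDeg (m d : ℕ) : Submodule ℂ (ConjPoly d) :=
  MvPolynomial.restrictTotalDegree (Fin d ⊕ Fin d) ℂ m

/-- `μ` has convergent moments up to at least degree `n`: every polynomial in
`ℂ_{n,d}[z, z̄]` is absolutely integrable. -/
def HasConvergentMoments {d : ℕ} (μ : Measure (Fin d → ℂ)) (n : ℕ) : Prop :=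
  ∀ p ∈ conjPolyDeg n d, Integrable (ConjPoly.toFun d p) μ

/-- The space `ℂ_{m,d}[z, z̄]|_K` of restrictions to `K` of the functions given by the
polynomials of degree at most `m`. -/
noncomputable def conjPolyRestrict (m : ℕ) {d : ℕ} (K : Set (Fin d → ℂ)) :
    Submodule ℂ (K → ℂ) :=
  (conjPolyDeg m d).map
    ((LinearMap.funLeft ℂ ℂ (Subtype.val : K → (Fin d → ℂ))).comp (ConjPoly.toFun d))

/-- The space of restrictions is finite-dimensional, so its `finrank` is its dimension. -/
theorem conjPolyRestrict_finite (m : ℕ) {d : ℕ} (K : Set (Fin d → ℂ)) :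
    Module.Finite ℂ (conjPolyRestrict m K) := by
  have : Module.Finite ℂ (conjPolyDeg m d) := by unfold conjPolyDeg; infer_instance
  unfold conjPolyRestrict; infer_instance

/-- `N_{m,d;μ}`, the dimension of `ℂ_{m,d}[z, z̄]|_{supp μ}`. -/
noncomputable def supportDim (m : ℕ) {d : ℕ} (μ : Measure (Fin d → ℂ)) : ℕ :=
  Module.finrank ℂ (conjPolyRestrict m μ.support)

/-! The mean of an integrable map `F : X → E` into a finite-dimensional real space lies in the convex
hull of `F '' S` for every conull set `S`; closedness of the hull is not needed
(`integral_mem_convexHull_image`). Indeed, if the mean, say `0`, were outside the hull, a nonzero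
functional `L` would satisfy `L ≤ 0` on the hull
(`Convex.exists_dual_ne_zero_le_zero_of_zero_notMem`). Since `∫ L ∘ F = 0`, this forces `L ∘ F = 0`
almost everywhere, so one may shrink `S`, pass to `ker L`, and induct on the dimension.

The restrictions to `K = supp μ` of the polynomials of degree at most `m` form a complex space stable
under conjugation, so it has a basis of `D = dim` real-valued functions
(`exists_real_basis_conjPolyRestrict`). These are the coordinates of a map `F` into `ℝ^D`.
The support is conull, so Carathéodory's theorem writes the mean of `F` as a convex combination of at
most `D + 1` values of `F` on `K`. This is a quadrature formula for the basis, hence by linearity for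
every polynomial. -/

/-! ### Means and convex hulls in finite dimension -/

/-- Weak separation of a point from a convex set, not necessarily closed, in finite dimension. -/
theorem Convex.exists_dual_ne_zero_le_zero_of_zero_notMem {E : Type*} [NormedAddCommGroup E]
    [NormedSpace ℝ E] [FiniteDimensional ℝ E] {C : Set E} (hC : Convex ℝ C)
    (hne : C.Nonempty) (h0 : (0 : E) ∉ C) :
    ∃ L : E →L[ℝ] ℝ, L ≠ 0 ∧ ∀ a ∈ C, L a ≤ 0 := by
  by_cases hint : (interior C).Nonempty
  · obtain ⟨f, hf, hle⟩ := geometric_hahn_banach_of_nonempty_interior_point hC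
      (fun h => h0 (interior_subset h)) hint
    exact ⟨f, hf, fun a ha => by simpa using hle a ha⟩
  -- Otherwise `C` lies in a hyperplane, on which some nonzero functional is constant.
  · have haff : affineSpan ℝ C ≠ ⊤ := fun h =>
      hint (hC.interior_nonempty_iff_affineSpan_eq_top.2 h)
    have hdir : vectorSpan ℝ C ≠ ⊤ := fun h =>
      haff ((AffineSubspace.affineSpan_eq_top_iff_vectorSpan_eq_top_of_nonempty ℝ E E hne).2 h)
    obtain ⟨f, hf, hker⟩ := Submodule.exists_le_ker_of_lt_top _ hdir.lt_top
    obtain ⟨x, hx⟩ := hne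
    have hconst : ∀ a ∈ C, f a = f x := fun a ha => by
      have h := hker (vsub_mem_vectorSpan ℝ ha hx)
      rw [LinearMap.mem_ker, vsub_eq_sub, map_sub] at h
      linarith
    have hne0 : LinearMap.toContinuousLinearMap f ≠ 0 := by simpa using hf
    rcases le_total (f x) 0 with h | h
    · exact ⟨LinearMap.toContinuousLinearMap f, hne0, fun a ha => by
        simpa [hconst a ha] using h⟩
    · exact ⟨-LinearMap.toContinuousLinearMap f, neg_ne_zero.2 hne0, fun a ha => by
        simpa [hconst a ha] using h⟩

/-- Induction on the dimension: a functional that is `≤ 0` on `F '' S` must vanish almost everywhere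
along `F`, so `F` takes almost all its values in the kernel. -/
theorem zero_mem_convexHull_image_of_integral_eq_zero {X : Type*} [MeasurableSpace X]
    {μ : Measure X} [NeZero μ] (n : ℕ) :
    ∀ {E : Type*} [NormedAddCommGroup E] [NormedSpace ℝ E] [FiniteDimensional ℝ E],
      Module.finrank ℝ E ≤ n → ∀ {F : X → E}, Integrable F μ → ∫ x, F x ∂μ = 0 →
      ∀ {S : Set X}, (∀ᵐ x ∂μ, x ∈ S) → (0 : E) ∈ convexHull ℝ (F '' S) := by
  induction n with
  | zero =>
    intro E _ _ _ hn F _ _ S hS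
    obtain ⟨x, hx⟩ := hS.exists
    have : Subsingleton E := Module.finrank_zero_iff.1 (Nat.le_zero.1 hn)
    exact subset_convexHull ℝ _ ⟨x, hx, Subsingleton.elim _ _⟩
  | succ n ih =>
    intro E _ _ _ hn F hF hF0 S hS
    by_contra hnot
    obtain ⟨x₀, hx₀⟩ := hS.exists
    obtain ⟨L, hL, hle⟩ := (convex_convexHull ℝ (F '' S)).exists_dual_ne_zero_le_zero_of_zero_notMem
      ⟨F x₀, subset_convexHull ℝ _ ⟨x₀, hx₀, rfl⟩⟩ hnot
    have hL0 : ∀ᵐ x ∂μ, L (F x) = 0 := by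
      have h1 : 0 ≤ᵐ[μ] fun x => -L (F x) := by
        filter_upwards [hS] with x hx
        simpa using hle _ (subset_convexHull ℝ _ ⟨x, hx, rfl⟩)
      have h2 : ∫ x, -L (F x) ∂μ = 0 := by
        rw [integral_neg, L.integral_comp_comm hF, hF0, map_zero, neg_zero]
      have h3 := (integral_eq_zero_iff_of_nonneg_ae h1 (L.integrable_comp hF).neg).1 h2
      filter_upwards [h3] with x hx
      simpa using hx
    let W : Submodule ℝ E := LinearMap.ker (L : E →ₗ[ℝ] ℝ)
    have hW : Module.finrank ℝ W ≤ n := by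
      have hlt : W ≠ ⊤ := fun h => hL <| by
        ext x
        have hx : x ∈ W := h ▸ Submodule.mem_top
        simpa [W] using hx
      have := Submodule.finrank_lt hlt
      omega
    -- A linear retraction onto `ker L` makes `F` take values in the smaller space.
    obtain ⟨P, hP⟩ := W.subtype.exists_leftInverse_of_injective W.ker_subtype
    let Q : E →L[ℝ] W := LinearMap.toContinuousLinearMap P
    have hQ : ∀ w : W, Q w = w := fun w => LinearMap.congr_fun hP w
    have key := ih hW (Q.integrable_comp hF) (by rw [Q.integral_comp_comm hF, hF0, map_zero])
      (S := {x | x ∈ S ∧ L (F x) = 0}) (hS.and hL0)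
    have key' := Set.mem_image_of_mem W.subtype key
    rw [W.subtype.image_convexHull, map_zero] at key'
    refine hnot (convexHull_mono ?_ key')
    rintro _ ⟨_, ⟨x, ⟨hx, hx0⟩, rfl⟩, rfl⟩
    exact ⟨x, hx, congrArg Subtype.val (hQ ⟨F x, hx0⟩).symm⟩

open scoped Pointwise in
/-- The mean of an integrable map into a finite-dimensional space lies in the convex hull, and not
only in the closed convex hull, of the image of any conull set. -/
theorem integral_mem_convexHull_image {X E : Type*} [MeasurableSpace X] {μ : Measure X}
    [IsProbabilityMeasure μ] [NormedAddCommGroup E] [NormedSpace ℝ E] [FiniteDimensional ℝ E]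
    {F : X → E} (hF : Integrable F μ) {S : Set X} (hS : ∀ᵐ x ∂μ, x ∈ S) :
    ∫ x, F x ∂μ ∈ convexHull ℝ (F '' S) := by
  set v := ∫ x, F x ∂μ with hv
  have h := zero_mem_convexHull_image_of_integral_eq_zero (μ := μ) _ le_rfl
    (hF.sub (integrable_const v)) (by rw [Pi.sub_def, integral_sub hF (integrable_const v)]; simp [hv]) hS
  have himg : (F - fun _ => v) '' S = F '' S + ({-v} : Set E) := by
    simp [Set.add_singleton, Set.image_image, ← sub_eq_add_neg]
  rw [himg, convexHull_add, convexHull_singleton, Set.add_singleton] at h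
  obtain ⟨y, hy, hy0⟩ := h
  rwa [add_neg_eq_zero.1 hy0] at hy

/-- Tchakaloff's theorem for finitely many real functions: the integrals against a finite measure
agree with those against a finite sum of positive point masses. -/
theorem exists_quadrature_of_integrable {X : Type*} [MeasurableSpace X] {μ : Measure X}
    [IsFiniteMeasure μ] {D : ℕ} {F : X → Fin D → ℝ} (hF : Integrable F μ) {S : Set X}
    (hS : ∀ᵐ x ∂μ, x ∈ S) :
    ∃ N : ℕ, N ≤ 1 + D ∧ ∃ (z : Fin N → X) (ρ : Fin N → ℝ),
      (∀ k, z k ∈ S) ∧ (∀ k, 0 < ρ k) ∧ ∫ x, F x ∂μ = ∑ k, ρ k • F (z k) := by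
  rcases eq_or_ne μ 0 with rfl | hμ
  · exact ⟨0, by omega, Fin.elim0, Fin.elim0, fun k => k.elim0, fun k => k.elim0, by simp⟩
  have : NeZero μ := ⟨hμ⟩
  set c : ℝ := μ.real Set.univ with hc
  have hcpos : 0 < c := by
    simp [hc, measureReal_def, ENNReal.toReal_pos_iff, pos_iff_ne_zero, hμ]
  let ν : Measure X := (μ Set.univ)⁻¹ • μ
  have hν : IsProbabilityMeasure ν := inferInstance
  have hFν : Integrable F ν := hF.smul_measure (by simp [hμ])
  have hmem := integral_mem_convexHull_image hFν (S := S) (Measure.ae_smul_measure hS _)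
  obtain ⟨ι, _, y, w, hy, hind, hw, -, hsum⟩ := eq_pos_convex_span_of_mem_convexHull hmem
  have hcard : Fintype.card ι ≤ 1 + D := by
    have h1 := hind.card_le_finrank_succ
    have h2 := Submodule.finrank_le (vectorSpan ℝ (Set.range y))
    rw [Module.finrank_fin_fun] at h2
    omega
  choose z hzS hzy using fun i => hy (Set.mem_range_self i)
  let e := (Fintype.equivFin ι).symm
  refine ⟨Fintype.card ι, hcard, z ∘ e, fun k => c * w (e k), fun k => hzS _,
    fun k => mul_pos hcpos (hw _), ?_⟩
  have hint : ∫ x, F x ∂μ = c • ∫ x, F x ∂ν := by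
    rw [integral_smul_measure, smul_smul, ENNReal.toReal_inv, ← measureReal_def, ← hc,
      mul_inv_cancel₀ hcpos.ne', one_smul]
  rw [hint, ← hsum, Finset.smul_sum, ← e.sum_comp]
  exact Finset.sum_congr rfl fun k _ => by simp [mul_smul, hzy]

/-! ### Conjugation of polynomials in `z` and its conjugate -/

/-- The conjugate polynomial: conjugate the coefficients and exchange `z_k` with its conjugate. -/
noncomputable def ConjPoly.conj {d : ℕ} (p : ConjPoly d) : ConjPoly d :=
  MvPolynomial.rename Sum.swap (MvPolynomial.map (starRingEnd ℂ) p)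

theorem ConjPoly.toFun_conj {d : ℕ} (p : ConjPoly d) (z : Fin d → ℂ) :
    ConjPoly.toFun d p.conj z = starRingEnd ℂ (ConjPoly.toFun d p z) := by
  simp only [ConjPoly.toFun, ConjPoly.conj, LinearMap.coe_mk, AddHom.coe_mk,
    MvPolynomial.eval_rename, MvPolynomial.eval_map]
  rw [MvPolynomial.eval, MvPolynomial.coe_eval₂Hom, ← RingHom.coe_coe (starRingEnd ℂ),
    MvPolynomial.hom_eval₂]
  congr 1
  funext i
  rcases i with i | i <;> simp

theorem ConjPoly.conj_mem_conjPolyDeg {d m : ℕ} {p : ConjPoly d} (hp : p ∈ conjPolyDeg m d) :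
    p.conj ∈ conjPolyDeg m d := by
  rw [conjPolyDeg, MvPolynomial.mem_restrictTotalDegree] at hp ⊢
  exact (MvPolynomial.totalDegree_rename_le _ _).trans
    ((Finset.sup_mono (MvPolynomial.support_map_subset _ _)).trans hp)

/-- The space of restrictions is stable under conjugation, hence spanned by its real-valued
elements. -/
theorem conjPolyRestrict_eq_span_real (m : ℕ) {d : ℕ} (K : Set (Fin d → ℂ)) :
    Submodule.span ℂ {f | f ∈ conjPolyRestrict m K ∧ ∀ x, ((f x).re : ℂ) = f x} =
      conjPolyRestrict m K := by
  refine le_antisymm (Submodule.span_le.2 fun f hf => hf.1) ?_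
  rintro _ ⟨p, hp, rfl⟩
  have hp' := ConjPoly.conj_mem_conjPolyDeg hp
  -- Real and imaginary parts: `p = (p + p̄)/2 + i · (-i/2) (p - p̄)`.
  have hdecomp : p = (1 / 2 : ℂ) • (p + p.conj) +
      Complex.I • (-(Complex.I / 2) • (p - p.conj)) := by
    rw [smul_smul, show Complex.I * -(Complex.I / 2) = 1 / 2 by
      linear_combination (-1 / 2 : ℂ) * Complex.I_mul_I]
    module
  rw [hdecomp, map_add, LinearMap.map_smul _ Complex.I]
  refine Submodule.add_mem _ (Submodule.subset_span ⟨⟨_, ?_, rfl⟩, fun x => ?_⟩)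
    (Submodule.smul_mem _ _ (Submodule.subset_span ⟨⟨_, ?_, rfl⟩, fun x => ?_⟩))
  · exact Submodule.smul_mem _ _ (Submodule.add_mem _ hp hp')
  · apply Complex.ext <;> simp [LinearMap.funLeft, ConjPoly.toFun_conj]
  · exact Submodule.smul_mem _ _ (Submodule.sub_mem _ hp hp')
  · apply Complex.ext <;> simp [LinearMap.funLeft, ConjPoly.toFun_conj]

/-- Polynomials that are real-valued on `K`, in number the complex dimension of the space of
restrictions, whose restrictions to `K` span that space. -/
theorem exists_real_basis_conjPolyRestrict (m : ℕ) {d : ℕ} (K : Set (Fin d → ℂ)) :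
    ∃ q : Fin (Module.finrank ℂ (conjPolyRestrict m K)) → ConjPoly d,
      (∀ i, q i ∈ conjPolyDeg m d) ∧
      (∀ i, ∀ x ∈ K, ((ConjPoly.toFun d (q i) x).re : ℂ) = ConjPoly.toFun d (q i) x) ∧
      ∀ p ∈ conjPolyDeg m d, ∃ c : Fin (Module.finrank ℂ (conjPolyRestrict m K)) → ℂ,
        ∀ x ∈ K, ConjPoly.toFun d p x = ∑ i, c i * ConjPoly.toFun d (q i) x := by
  have hspan := conjPolyRestrict_eq_span_real m K
  have hfin : Module.Finite ℂ (Submodule.span ℂ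
      {f | f ∈ conjPolyRestrict m K ∧ ∀ x, ((f x).re : ℂ) = f x}) := by
    rw [hspan]
    exact conjPolyRestrict_finite m K
  have hbasis := Submodule.exists_fun_fin_finrank_span_eq ℂ
    {f | f ∈ conjPolyRestrict m K ∧ ∀ x, ((f x).re : ℂ) = f x}
  rw [hspan] at hbasis
  obtain ⟨f, hf, hfspan, -⟩ := hbasis
  choose q hq hqf using fun i => (hf i).1
  have hqf' : ∀ i, ∀ x (hx : x ∈ K), f i ⟨x, hx⟩ = ConjPoly.toFun d (q i) x :=
    fun i x hx => (congrFun (hqf i) ⟨x, hx⟩).symm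
  refine ⟨q, hq, fun i x hx => by simpa [hqf'] using (hf i).2 ⟨x, hx⟩, fun p hp => ?_⟩
  have hmem : (LinearMap.funLeft ℂ ℂ (Subtype.val : K → (Fin d → ℂ))).comp (ConjPoly.toFun d) p ∈
      Submodule.span ℂ (Set.range f) := by
    rw [hfspan]
    exact ⟨p, hp, rfl⟩
  obtain ⟨c, hc⟩ := (Submodule.mem_span_range_iff_exists_fun ℂ).1 hmem
  refine ⟨c, fun x hx => ?_⟩
  simpa [hqf', LinearMap.funLeft] using (congrFun hc ⟨x, hx⟩).symm

/-! ### Quadrature for polynomials in `z` and its conjugate -/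

theorem theorem3p1 (d n : ℕ) (hn : 1 ≤ n) (μ : Measure (Fin d → ℂ))
    (hμ : HasConvergentMoments μ n) :
    ∃ N : ℕ, N ≤ 1 + supportDim (n - 1) μ ∧
      ∃ (z : Fin N → (Fin d → ℂ)) (ρ : Fin N → ℝ),
        (∀ k, z k ∈ μ.support) ∧ (∀ k, 0 < ρ k) ∧
        ∀ p ∈ conjPolyDeg (n - 1) d,
          ∫ w in μ.support, ConjPoly.toFun d p w ∂μ =
            ∑ k, (ρ k : ℂ) * ConjPoly.toFun d p (z k) := by
  have hle : conjPolyDeg (n - 1) d ≤ conjPolyDeg n d := fun p hp => by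
    rw [conjPolyDeg, MvPolynomial.mem_restrictTotalDegree] at hp ⊢
    omega
  -- The constant polynomial `1` is integrable.
  have hfin : IsFiniteMeasure μ := by
    have h := hμ 1 (by simp [conjPolyDeg, MvPolynomial.mem_restrictTotalDegree])
    have h1 : ConjPoly.toFun d 1 = fun _ => (1 : ℂ) := by
      funext z
      simp [ConjPoly.toFun]
    rw [h1, integrable_const_iff] at h
    exact h.resolve_left one_ne_zero
  have hsupp : ∀ᵐ x ∂μ, x ∈ μ.support := Measure.support_mem_ae
  obtain ⟨q, hq, hreal, hspan⟩ := exists_real_basis_conjPolyRestrict (n - 1) μ.support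
  have hint : ∀ i, Integrable (ConjPoly.toFun d (q i)) μ := fun i => hμ _ (hle (hq i))
  have hre : ∀ i, Integrable (fun x => (ConjPoly.toFun d (q i) x).re) μ := fun i => (hint i).re
  obtain ⟨N, hN, z, ρ, hz, hρ, hquad⟩ := exists_quadrature_of_integrable
    (F := fun x i => (ConjPoly.toFun d (q i) x).re) (Integrable.of_eval hre) hsupp
  refine ⟨N, hN, z, ρ, hz, hρ, fun p hp => ?_⟩
  have hquad' : ∀ i, ∫ x, ConjPoly.toFun d (q i) x ∂μ =
      ∑ k, (ρ k : ℂ) * ConjPoly.toFun d (q i) (z k) := fun i => by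
    have h := congrFun hquad i
    rw [eval_integral hre] at h
    calc ∫ x, ConjPoly.toFun d (q i) x ∂μ
        = ∫ x, ((ConjPoly.toFun d (q i) x).re : ℂ) ∂μ :=
          integral_congr_ae (hsupp.mono fun x hx => (hreal i x hx).symm)
      _ = ((∫ x, (ConjPoly.toFun d (q i) x).re ∂μ : ℝ) : ℂ) := integral_ofReal
      _ = ∑ k, (ρ k : ℂ) * ConjPoly.toFun d (q i) (z k) := by
          rw [h, Finset.sum_apply, Complex.ofReal_sum]
          exact Finset.sum_congr rfl fun k _ => by simp [hreal i (z k) (hz k)]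
  obtain ⟨c, hc⟩ := hspan p hp
  calc ∫ w in μ.support, ConjPoly.toFun d p w ∂μ
      = ∫ w, ∑ i, c i * ConjPoly.toFun d (q i) w ∂μ := by
        rw [Measure.restrict_eq_self_of_ae_mem hsupp]
        exact integral_congr_ae (hsupp.mono hc)
    _ = ∑ i, c i * ∑ k, (ρ k : ℂ) * ConjPoly.toFun d (q i) (z k) := by
        rw [integral_finsetSum _ fun i _ => (hint i).const_mul (c i)]
        exact Finset.sum_congr rfl fun i _ => by rw [integral_const_mul, hquad']
    _ = ∑ k, (ρ k : ℂ) * ConjPoly.toFun d p (z k) := by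
        simp_rw [Finset.mul_sum, hc _ (hz _)]
        rw [Finset.sum_comm]
        simp_rw [Finset.mul_sum, mul_left_comm]
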